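/- Let $m\ge 1$ be odd and let $\mathbb R_{0,m}$ be the real Clifford algebra generated by $e_1,\dots,e_m$ with $e_j^2=-1$ and $e_je_k+e_ke_j=0$ for $j\ne k$, with norm $|a|^2=\sum_A a_A^2$ for $a=\sum_A a_Ae_A$. For $x=(x_0,x_1,\dots,x_m)\in\mathbb R^{m+1}$ write $\underline x=\sum_{j=1}^m x_je_j$, $r=|\underline x|$ and, if $\underline x\neq 0$, $\underline\omega=\underline x/r$. Put $\partial_{\underline x}=\sum_{j=1}^m e_j\partial_{x_j}$ and $\Delta_x=\sum_{j=0}^m\partial_{x_j}^2$. A $C^1$ function $F:\mathbb R^{m+1}\to\mathbb R_{0,m}$ is called monogenic if $\partial_{x_0}F+\partial_{\underline x}F=0$. The CK-extension of $f:\mathbb R^m\to\mathbb R_{0,m}$ is the monogenic function $\mathsf{CK}[f]$ on $\mathbb R^{m+1}$ with $\mathsf{CK}[f]|_{x_0=0}=f$ that is given by the convergent series \[\mathsf{CK}[f](x)=\sum_{n=0}^\infty\frac{(-x_0)^n}{n!}\,\partial_{\underline x}^nf(\underline x).\] For holomorphic $h(z)=u+iv$ put \[\mathsf{Ft}[h(z),1](x)=\Delta_x^{\frac{m-1}{2}}\bigl[u(x_0,r)+\underline\omega\,v(x_0,r)\bigr]\qquad(\underline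 x\ne0),\] and for functions of $r>0$ put $D_r(n)\{g\}=\bigl(\tfrac1r\partial_r\bigr)^n g$, $D^r(0)\{g\}=g$ and $D^r(n)\{g\}=\partial_r\bigl(D^r(n-1)\{g\}/r\bigr)$ for $n\ge1$. Then the Gaussian distribution $\exp(-|\underline x|^2/2)$ in $\mathbb R^m$ has a CK-extension to $\mathbb R^{m+1}$ (the series converges at every point, its sum is monogenic and it restricts to the Gaussian on $x_0=0$), and it is given in closed form by \[\mathsf{CK}[\exp(-|\underline x|^2/2)](x)=\begin{cases}(-1)^{\frac{m-1}{2}}\,\dfrac{\mathsf{Ft}[\exp(z^2/2),1](x)}{(m-1)!!}&\text{for }\underline x\ne0,\\[2ex]\exp(x_0^2/2)\left(1+\displaystyle\sum_{n=1}^{\frac{m-1}{2}}\ \prod_{\nu=1}^n\bigl(m-(2\nu-1)\bigr)\frac{x_0^{2n}}{(2n)!}\right)&\text{for }\underline x=0,\end{cases}\] where, for $\underline x\ne0$ and with $N=\frac{m-1}{2}$, \[\mathsf{Ft}[\exp(z^2/2),1](x)=(m-1)!!\,\exp\Bigl(\frac{x_0^2-r^2}{2}\Bigr)\left(\sum_{\nu=0}^{N}\binom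 N\nu(-1)^{N-\nu}D_r(\nu)\{\cos(x_0r)\}+\underline\omega\sum_{\nu=0}^{N}\binom N\nu(-1)^{N-\nu}D^r(\nu)\{\sin(x_0r)\}\right).\] -/

import Mathlib

noncomputable section

namespace MonogenicGaussian

/-! ### The Clifford algebra `ℝ_{0,m}` -/

/-- The quadratic form `v ↦ -∑ j, v j ^ 2` on `ℝ^m`. -/
abbrev negSq (m : ℕ) : QuadraticForm ℝ (Fin m → ℝ) :=
  QuadraticMap.weightedSumSquares ℝ (fun _ : Fin m => (-1 : ℝ))

/-- The real Clifford algebra `ℝ_{0,m}`, in which `v * v = -|v|²` for every vector `v`. -/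
abbrev Cl (m : ℕ) : Type := CliffordAlgebra (negSq m)

/-- The embedding of vectors `x₁ e₁ + ⋯ + x_m e_m` of `ℝ^m` into `ℝ_{0,m}`. -/
def vec {m : ℕ} (x : EuclideanSpace ℝ (Fin m)) : Cl m :=
  CliffordAlgebra.ι (negSq m) (fun j => x j)

/-- The generators `e₁, …, e_m` (numbered from `0`). -/
def e (m : ℕ) (j : Fin m) : Cl m := CliffordAlgebra.ι (negSq m) (Pi.single j 1)

/-- The basis `(e_A)` of `ℝ_{0,m}`, indexed by the subsets `A` of the index set; see
`clBasis_apply`. -/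
def clBasis (m : ℕ) : Module.Basis (Finset (Fin m)) ℝ (Cl m) :=
  ((Pi.basisFun ℝ (Fin m)).ExteriorAlgebra).map (CliffordAlgebra.equivExterior (negSq m)).symm

theorem associated_negSq_single {m : ℕ} {i j : Fin m} (h : i ≠ j) :
    (QuadraticMap.associated (R := ℝ) (M := Fin m → ℝ) (-negSq m))
      (Pi.single i (1 : ℝ)) (Pi.single j (1 : ℝ)) = 0 := by
  have h1 : ∀ v : Fin m → ℝ, (-negSq m) v = ∑ k, v k * v k := by
    intro v
    simp [negSq, QuadraticMap.weightedSumSquares_apply]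
  rw [QuadraticMap.associated_apply, h1, h1, h1]
  have h2 : ∑ k, (Pi.single i (1 : ℝ) + Pi.single j (1 : ℝ) : Fin m → ℝ) k *
      (Pi.single i (1 : ℝ) + Pi.single j (1 : ℝ) : Fin m → ℝ) k
      = ∑ k, (Pi.single i (1 : ℝ) : Fin m → ℝ) k * (Pi.single i (1 : ℝ) : Fin m → ℝ) k
      + ∑ k, (Pi.single j (1 : ℝ) : Fin m → ℝ) k * (Pi.single j (1 : ℝ) : Fin m → ℝ) k := by
    rw [← Finset.sum_add_distrib]
    refine Finset.sum_congr rfl fun k _ => ?_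
    by_cases hi : k = i
    · subst hi
      simp [Pi.single_eq_of_ne h]
    · simp [Pi.single_eq_of_ne hi]
  rw [h2]
  simp

theorem contractLeft_prod {m : ℕ} (i : Fin m) (L : List (Fin m)) (h : i ∉ L) :
    CliffordAlgebra.contractLeft (Q := (0 : QuadraticForm ℝ (Fin m → ℝ)))
      ((QuadraticMap.associated (R := ℝ) (M := Fin m → ℝ) (-negSq m)) (Pi.single i (1 : ℝ)))
      (L.map fun j => CliffordAlgebra.ι (0 : QuadraticForm ℝ (Fin m → ℝ))
        (Pi.single j (1 : ℝ))).prod = 0 := by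
  induction L with
  | nil => simp [CliffordAlgebra.contractLeft_one]
  | cons j L ih =>
    simp only [List.mem_cons, not_or] at h
    rw [List.map_cons, List.prod_cons, CliffordAlgebra.contractLeft_ι_mul, ih h.2,
      associated_negSq_single h.1]
    simp

theorem equivExterior_prod {m : ℕ} (L : List (Fin m)) (h : L.Nodup) :
    CliffordAlgebra.equivExterior (negSq m) (L.map (e m)).prod =
      (L.map fun j => CliffordAlgebra.ι (0 : QuadraticForm ℝ (Fin m → ℝ))
        (Pi.single j (1 : ℝ))).prod := by
  induction L with
  | nil => exact CliffordAlgebra.changeForm_one CliffordAlgebra.changeForm.associated_neg_proof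
  | cons j L ih =>
    rw [List.nodup_cons] at h
    rw [List.map_cons, List.prod_cons, List.map_cons, List.prod_cons, ← ih h.2]
    refine (CliffordAlgebra.changeForm_ι_mul
      CliffordAlgebra.changeForm.associated_neg_proof _ _).trans ?_
    have := contractLeft_prod j L h.1
    rw [← ih h.2] at this
    exact (congrArg (fun t => _ - t) this).trans (sub_zero _)

/-- `e_A = e_{j₁} ⋯ e_{j_k}` for `A = {j₁ < ⋯ < j_k}`. -/
theorem clBasis_apply (m : ℕ) (A : Finset (Fin m)) :
    clBasis m A = ((A.sort (· ≤ ·)).map (e m)).prod := by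
  rw [clBasis, Module.Basis.map_apply, LinearEquiv.symm_apply_eq,
    equivExterior_prod _ (A.sort_nodup (· ≤ ·)), ExteriorAlgebra.basis_apply]
  change (List.ofFn fun i => CliffordAlgebra.ι (0 : QuadraticForm ℝ (Fin m → ℝ))
    (Pi.basisFun ℝ (Fin m) (A.orderEmbOfFin rfl i))).prod = _
  simp only [Pi.basisFun_apply]
  congr 1
  apply List.ext_getElem
  · simp
  · intro i h1 h2
    simp [Finset.orderEmbOfFin_apply]

/-- The coordinates `(a_A)` of a Clifford number `a = ∑ a_A e_A`. -/
def clCoord (m : ℕ) : Cl m ≃ₗ[ℝ] EuclideanSpace ℝ (Finset (Fin m)) :=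
  (clBasis m).equivFun.trans (WithLp.linearEquiv 2 ℝ (Finset (Fin m) → ℝ)).symm

/-- The norm `|a|² = ∑ a_A²` of Clifford numbers. -/
instance instNormedAddCommGroupCl (m : ℕ) : NormedAddCommGroup (Cl m) :=
  NormedAddCommGroup.induced (Cl m) (EuclideanSpace ℝ (Finset (Fin m)))
    (clCoord m).toLinearMap (clCoord m).injective

instance instNormedSpaceCl (m : ℕ) : NormedSpace ℝ (Cl m) :=
  NormedSpace.induced ℝ (Cl m) (EuclideanSpace ℝ (Finset (Fin m))) (clCoord m).toLinearMap

theorem norm_sq_eq {m : ℕ} (a : Cl m) : ‖a‖ ^ 2 = ∑ A, ((clBasis m).repr a A) ^ 2 := by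
  have : ‖a‖ = ‖clCoord m a‖ := rfl
  rw [this, EuclideanSpace.norm_sq_eq]
  simp [clCoord]

/-! ### Differential operators and monogenic functions -/

/-- The vector part `x̲ = (x₁, …, x_m)` of `x = (x₀, x₁, …, x_m)`. -/
def under {m : ℕ} (x : EuclideanSpace ℝ (Fin (m + 1))) : EuclideanSpace ℝ (Fin m) :=
  WithLp.toLp 2 (fun j => x j.succ)

/-- The point `(0, x₁, …, x_m)` of the hyperplane `x₀ = 0`. -/
def atZero {m : ℕ} (x : EuclideanSpace ℝ (Fin m)) : EuclideanSpace ℝ (Fin (m + 1)) :=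
  WithLp.toLp 2 (Fin.cons 0 (fun j => x j))

/-- The Dirac operator `∑ j, e_j ∂_{x_j}` on `ℝ^m`. -/
def dirac {m : ℕ} (f : EuclideanSpace ℝ (Fin m) → Cl m) (x : EuclideanSpace ℝ (Fin m)) : Cl m :=
  ∑ j, e m j * fderiv ℝ f x (EuclideanSpace.single j 1)

/-- The generalized Cauchy-Riemann operator `∂_{x₀} + ∑ j, e_j ∂_{x_j}` on `ℝ^{m+1}`. -/
def cauchyRiemann {m : ℕ} (f : EuclideanSpace ℝ (Fin (m + 1)) → Cl m)
    (x : EuclideanSpace ℝ (Fin (m + 1))) : Cl m :=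
  fderiv ℝ f x (EuclideanSpace.single 0 1) +
    ∑ j : Fin m, e m j * fderiv ℝ f x (EuclideanSpace.single j.succ 1)

/-- (Left) monogenic functions on all of `ℝ^{m+1}`. -/
def IsMonogenic {m : ℕ} (f : EuclideanSpace ℝ (Fin (m + 1)) → Cl m) : Prop :=
  ContDiff ℝ 1 f ∧ ∀ x, cauchyRiemann f x = 0

/-! ### The Cauchy-Kowalevski extension -/

/-- The terms `(-x₀)^n / n! · ∂_{x̲}^n f(x̲)` of the Cauchy-Kowalevski series. -/
def ckTerm {m : ℕ} (f : EuclideanSpace ℝ (Fin m) → Cl m) (x : EuclideanSpace ℝ (Fin (m + 1)))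
    (n : ℕ) : Cl m :=
  ((-(x 0)) ^ n / (n.factorial : ℝ)) • (dirac^[n] f) (under x)

/-- The sum of the Cauchy-Kowalevski series of `f`. -/
def CK {m : ℕ} (f : EuclideanSpace ℝ (Fin m) → Cl m) (x : EuclideanSpace ℝ (Fin (m + 1))) : Cl m :=
  ∑' n, ckTerm f x n

/-- `F` is the CK-extension of `f` to `ℝ^{m+1}`: it is monogenic on `ℝ^{m+1}`, it extends `f`, and
it is at every point the sum of the (convergent) Cauchy-Kowalevski series of `f`. -/
structure IsCKExtension {m : ℕ} (f : EuclideanSpace ℝ (Fin m) → Cl m)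
    (F : EuclideanSpace ℝ (Fin (m + 1)) → Cl m) : Prop where
  monogenic : IsMonogenic F
  restrict : ∀ x, F (atZero x) = f x
  hasSum : ∀ x, HasSum (ckTerm f x) (F x)

theorem IsCKExtension.eq_CK {m : ℕ} {f : EuclideanSpace ℝ (Fin m) → Cl m}
    {F : EuclideanSpace ℝ (Fin (m + 1)) → Cl m} (h : IsCKExtension f F) : F = CK f :=
  funext fun x => (h.hasSum x).tsum_eq.symm

/-! ### Fueter's construction -/

/-- The function `(u(x₀, r) + ω v(x₀, r)) P(x̲)`, where `f = u + i v`, `r = |x̲|`, `ω = x̲ / r`. -/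
def axialLift {m : ℕ} (f : ℂ → ℂ) (P : EuclideanSpace ℝ (Fin m) → Cl m)
    (x : EuclideanSpace ℝ (Fin (m + 1))) : Cl m :=
  (algebraMap ℝ (Cl m) (f ⟨x 0, ‖under x‖⟩).re +
    (f ⟨x 0, ‖under x‖⟩).im • vec (‖under x‖⁻¹ • under x)) * P (under x)

/-- `Ft[f, P] = Δ^{k + (m-1)/2} [(u(x₀, r) + ω v(x₀, r)) P(x̲)]`, where `m` is odd and `k` is the
degree of `P`; meaningful at the points with `x̲ ≠ 0`. -/
def Ft {m : ℕ} (k : ℕ) (f : ℂ → ℂ) (P : EuclideanSpace ℝ (Fin m) → Cl m) :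
    EuclideanSpace ℝ (Fin (m + 1)) → Cl m :=
  (fun g : EuclideanSpace ℝ (Fin (m + 1)) → Cl m => Laplacian.laplacian g)^[k + (m - 1) / 2]
    (axialLift f P)

/-- The operator `D_r(n) = ((1/r) ∂_r)^n`. -/
def lowerD : ℕ → (ℝ → ℝ) → ℝ → ℝ
  | 0, f => f
  | n + 1, f => fun r => (1 / r) * deriv (lowerD n f) r

/-- The operator `D^r(n)`: `D^r(0) f = f`, `D^r(n) f = ∂_r (D^r(n-1) f / r)`. -/
def upperD : ℕ → (ℝ → ℝ) → ℝ → ℝ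
  | 0, f => f
  | n + 1, f => deriv (fun r => upperD n f r / r)

/-- The Gaussian distribution `exp(-|x̲|²/2)` on `ℝ^m`. -/
def gaussian (m : ℕ) (x : EuclideanSpace ℝ (Fin m)) : Cl m :=
  algebraMap ℝ (Cl m) (Real.exp (-‖x‖ ^ 2 / 2))

end MonogenicGaussian

end

noncomputable section

namespace MonogenicGaussian

/-! ### Spherical Bessel functions in the variable `z ^ 2` -/

/-! Write `exp (z²/2) = u + iv` with `z = a + ir`, put `s = r²`, and let `u_n`, `v_n` be the images
of `u`, `v/r` under `((1/r)∂_r)^n = (2∂_s)^n`; these are `evenPart n`, `oddPart n`. In the variable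
`s` they are smooth through `r = 0`, since `cos (ar)` and `sin (ar)/r` are even in `r`. The
Cauchy-Riemann equations become `∂_a v_n = -u_{n+1}` and `∂_a u_n = (2n+1) v_n + s v_{n+1}`.

For `A_n = u_n + x̲ v_n` (`axial n`) these relations give `(∂_{x₀} + ∂_{x̲}) A_n = (2n+1-m) v_n`
(`cauchyRiemann_axial`) and `Δ A_n = (m-1-2n) A_{n+1}` (`laplacian_axial`). With `m = 2N+1`, the
Fueter transform `Δ^N A_0` is therefore `(2N)!! A_N`, and `A_N` is monogenic. On `x₀ = 0` it equals
`(-1)^N exp (-|x̲|²/2)`.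

For a monogenic `F`, each `∂_{x̲}` on `x₀ = 0` can be traded for `-∂_{x₀}`
(`iterate_dirac_comp_atZero`), so the CK series of `F|_{x₀=0}` is the Taylor series of `F` in `x₀`.
It converges everywhere to `F` because `u_N`, `v_N` are entire in `a` (`isCKExtension_of_axial`).
The closed forms are the Leibniz expansions of `u_N`, `v_N`, written with the functions `J_n`
obtained from `cos √w` by repeatedly applying `-2 d/dw`. -/

/-- The entire function `w ↦ cos √w`. -/
def cosSqrt (w : ℂ) : ℂ := ∑' k : ℕ, (-1) ^ k * w ^ k / ((2 * k).factorial : ℂ)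

theorem cosSqrt_sq (z : ℂ) : cosSqrt (z ^ 2) = Complex.cos z := by
  rw [← (Complex.hasSum_cos z).tsum_eq, cosSqrt]
  simp only [pow_mul]

/-- Weierstrass test on the ball of radius `‖w‖ + 1`, with the exponential series as majorant
because `k! ≤ (2k)!`. -/
theorem differentiable_cosSqrt : Differentiable ℂ cosSqrt := by
  intro w
  have h : DifferentiableOn ℂ cosSqrt (Metric.ball 0 (‖w‖ + 1)) := by
    refine Complex.differentiableOn_tsum_of_summable_norm
      (u := fun k : ℕ => (‖w‖ + 1) ^ k / (k.factorial : ℝ)) (Real.summable_pow_div_factorial _)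
      (fun k => by fun_prop) Metric.isOpen_ball fun k z hz => ?_
    have hz' : ‖z‖ ≤ ‖w‖ + 1 := by simpa using (mem_ball_zero_iff.1 hz).le
    have hk : (k.factorial : ℝ) ≤ ((2 * k).factorial : ℝ) :=
      Nat.cast_le.2 (Nat.factorial_le (by omega))
    rw [norm_div, norm_mul, norm_pow, norm_neg, norm_one, one_pow, one_mul, norm_pow,
      Complex.norm_natCast]
    have := k.factorial_pos
    gcongr
  exact (h w (by simp)).differentiableAt (Metric.isOpen_ball.mem_nhds (by simp))

/-- The entire functions `J₀(w) = cos √w`, `J_{n+1} = -2 J_n'`. -/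
def cbessel : ℕ → ℂ → ℂ
  | 0 => cosSqrt
  | n + 1 => fun w => -2 * deriv (cbessel n) w

theorem differentiable_cbessel (n : ℕ) : Differentiable ℂ (cbessel n) := by
  induction n with
  | zero => exact differentiable_cosSqrt
  | succ n ih =>
    have h : Differentiable ℂ (deriv (cbessel n)) := fun w =>
      ((ih.analyticAt w).deriv).differentiableAt
    exact h.const_mul _

theorem hasDerivAt_cbessel (n : ℕ) (w : ℂ) :
    HasDerivAt (cbessel n) (-(1 / 2) * cbessel (n + 1) w) w := by
  have h := (differentiable_cbessel n w).hasDerivAt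
  have e : -(1 / 2) * cbessel (n + 1) w = deriv (cbessel n) w := by
    simp only [cbessel]; ring
  rwa [e]

theorem mul_cbessel_one (z : ℂ) : z * cbessel 1 (z ^ 2) = Complex.sin z := by
  have h1 : HasDerivAt (fun z : ℂ => cbessel 0 (z ^ 2))
      (-(1 / 2) * cbessel 1 (z ^ 2) * (2 * z)) z := by
    have := (hasDerivAt_cbessel 0 (z ^ 2)).comp z (hasDerivAt_pow 2 z)
    rwa [Nat.cast_two, pow_one] at this
  have h2 : (fun z : ℂ => cbessel 0 (z ^ 2)) = Complex.cos := funext cosSqrt_sq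
  rw [h2] at h1
  linear_combination -(h1.unique (Complex.hasDerivAt_cos z))

/-- The Bessel three-term recurrence. For `n = 0` it is the derivative of `z J₁(z²) = sin z`;
differentiating the relation in `w` raises `n` by one. -/
theorem mul_cbessel_add_two (n : ℕ) (w : ℂ) :
    w * cbessel (n + 2) w = (2 * n + 1) * cbessel (n + 1) w - cbessel n w := by
  induction n generalizing w with
  | zero =>
    -- Over `ℂ` every `w` is a square, so the trigonometric identity reaches all `w`, including
    -- negative reals.
    obtain ⟨z, rfl⟩ : ∃ z : ℂ, z ^ 2 = w := ⟨w ^ (1 / 2 : ℂ), by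
      rw [← Complex.cpow_nat_mul]; simp⟩
    have h1 : HasDerivAt (fun z : ℂ => z * cbessel 1 (z ^ 2))
        (1 * cbessel 1 (z ^ 2) + z * (-(1 / 2) * cbessel 2 (z ^ 2) * (2 * z))) z := by
      have := (hasDerivAt_cbessel 1 (z ^ 2)).comp z (hasDerivAt_pow 2 z)
      rw [Nat.cast_two, pow_one] at this
      exact (hasDerivAt_id z).mul this
    have h2 : (fun z : ℂ => z * cbessel 1 (z ^ 2)) = Complex.sin := funext mul_cbessel_one
    rw [h2] at h1
    have h3 := h1.unique (Complex.hasDerivAt_sin z)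
    rw [← cosSqrt_sq] at h3
    simp only [Nat.cast_zero, mul_zero, zero_add, one_mul]
    change _ = cbessel 1 (z ^ 2) - cosSqrt (z ^ 2)
    linear_combination -h3
  | succ n ih =>
    have h1 := (hasDerivAt_id w).mul (hasDerivAt_cbessel (n + 2) w)
    have h2 := ((hasDerivAt_cbessel (n + 1) w).const_mul (2 * (n : ℂ) + 1)).sub
      (hasDerivAt_cbessel n w)
    have h3 : (id * cbessel (n + 2) : ℂ → ℂ) =
      (fun w => (2 * (n : ℂ) + 1) * cbessel (n + 1) w) - cbessel n := funext fun w => ih w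
    have h4 := h1.unique (h3 ▸ h2)
    push_cast
    simp only [id] at h4
    linear_combination -2 * h4

/-- The restriction of `cbessel n` to the real line. -/
def bessel (n : ℕ) (w : ℝ) : ℝ := (cbessel n w).re

theorem hasDerivAt_bessel (n : ℕ) (w : ℝ) :
    HasDerivAt (bessel n) (-(1 / 2) * bessel (n + 1) w) w := by
  have h := (hasDerivAt_cbessel n w).real_of_complex
  have e : (-(1 / 2) * cbessel (n + 1) w).re = -(1 / 2) * bessel (n + 1) w := by
    rw [bessel, show (-(1 / 2) : ℂ) = ((-(1 / 2) : ℝ) : ℂ) by push_cast; ring, Complex.re_ofReal_mul]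
  rwa [e] at h

theorem contDiff_bessel (n : ℕ) {k : WithTop ℕ∞} : ContDiff ℝ k (bessel n) :=
  (differentiable_cbessel n).contDiff.real_of_complex

/-- The power series of `J₀` has real coefficients, and differentiation along the real axis
preserves real values. Complex identities thus descend to `bessel`. -/
theorem ofReal_bessel (n : ℕ) (w : ℝ) : (bessel n w : ℂ) = cbessel n w := by
  induction n generalizing w with
  | zero =>
    have h : cbessel 0 w =
        ((∑' k : ℕ, (-1) ^ k * w ^ k / ((2 * k).factorial : ℝ) : ℝ) : ℂ) := by
      rw [Complex.ofReal_tsum]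
      simp [cbessel, cosSqrt]
    rw [bessel, h, Complex.ofReal_re]
  | succ n ih =>
    have h1 := (hasDerivAt_cbessel n w).comp_ofReal
    have h2 := (hasDerivAt_bessel n w).ofReal_comp
    simp only [ih] at h2
    have := h2.unique h1
    push_cast at this
    linear_combination -2 * this

theorem mul_bessel_add_two (n : ℕ) (w : ℝ) :
    w * bessel (n + 2) w = (2 * n + 1) * bessel (n + 1) w - bessel n w := by
  have := mul_cbessel_add_two n w
  rw [← ofReal_bessel, ← ofReal_bessel, ← ofReal_bessel] at this
  exact_mod_cast this

theorem bessel_zero_sq (t : ℝ) : bessel 0 (t ^ 2) = Real.cos t := by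
  have := cosSqrt_sq t
  rw [bessel, Complex.ofReal_pow]
  exact (congrArg Complex.re this).trans (Complex.cos_ofReal_re t)

theorem mul_bessel_one_sq (t : ℝ) : t * bessel 1 (t ^ 2) = Real.sin t := by
  have := mul_cbessel_one t
  rw [← Complex.ofReal_pow, ← ofReal_bessel] at this
  exact_mod_cast this

theorem mul_bessel_succ_zero (n : ℕ) : (2 * n + 1) * bessel (n + 1) 0 = bessel n 0 := by
  have := mul_bessel_add_two n 0
  linarith

/-! ### Real functions with an entire extension -/

/-- Real functions that are restrictions of entire functions. -/
def RealEntire (g : ℝ → ℝ) : Prop := ∃ G : ℂ → ℂ, Differentiable ℂ G ∧ ∀ t : ℝ, G t = g t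

theorem RealEntire.ofReal_iteratedDeriv {g : ℝ → ℝ} {G : ℂ → ℂ} (hG : Differentiable ℂ G)
    (h : ∀ t : ℝ, G t = g t) (n : ℕ) (t : ℝ) : iteratedDeriv n G t = iteratedDeriv n g t := by
  induction n generalizing g G t with
  | zero => simpa using h t
  | succ n ih =>
    rw [iteratedDeriv_succ', iteratedDeriv_succ']
    refine ih (fun w => ((hG.analyticAt w).deriv).differentiableAt) (fun t => ?_) t
    have h1 := (hG t).hasDerivAt.comp_ofReal
    have h2 := (hG t).hasDerivAt.real_of_complex
    have h3 : (fun t : ℝ => (G t).re) = g := funext fun t => by rw [h, Complex.ofReal_re]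
    rw [h3] at h2
    simp only [h] at h1
    rw [h2.deriv]
    exact h1.unique h2.ofReal_comp

/-- The source of convergence of the CK series: the Taylor series of the entire extension converges
everywhere, and its coefficients at `0` are those of `g`. -/
theorem RealEntire.hasSum {g : ℝ → ℝ} (hg : RealEntire g) (t : ℝ) :
    HasSum (fun n : ℕ => t ^ n / (n.factorial : ℝ) * iteratedDeriv n g 0) (g t) := by
  obtain ⟨G, hG, h⟩ := hg
  have h1 := Complex.hasSum_taylorSeries_of_entire hG 0 t
  rw [h] at h1
  have e : ∀ n : ℕ, (n.factorial : ℂ)⁻¹ • ((t : ℂ) - 0) ^ n • iteratedDeriv n G 0 =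
      ((t ^ n / (n.factorial : ℝ) * iteratedDeriv n g 0 : ℝ) : ℂ) := fun n => by
    have := ofReal_iteratedDeriv hG h n 0
    rw [Complex.ofReal_zero] at this
    rw [this]
    push_cast
    simp only [sub_zero, smul_eq_mul]
    ring
  simp only [e] at h1
  exact Complex.hasSum_ofReal.1 h1

/-! ### The components of the iterated Fueter transform of `exp (z ^ 2 / 2)` -/

/-- With `s = r²`, the function `((1/r) ∂_r)^n (exp ((a² - r²) / 2) cos (a r))`. -/
def evenPart (n : ℕ) (a s : ℝ) : ℝ :=
  (-1) ^ n * Real.exp ((a ^ 2 - s) / 2) *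
    ∑ ν ∈ Finset.range (n + 1), (n.choose ν : ℝ) * (a ^ (2 * ν) * bessel ν (a ^ 2 * s))

/-- With `s = r²`, the function `((1/r) ∂_r)^n (exp ((a² - r²) / 2) sin (a r) / r)`. -/
def oddPart (n : ℕ) (a s : ℝ) : ℝ :=
  (-1) ^ n * Real.exp ((a ^ 2 - s) / 2) *
    ∑ ν ∈ Finset.range (n + 1), (n.choose ν : ℝ) * (a ^ (2 * ν + 1) * bessel (ν + 1) (a ^ 2 * s))

/-- Pascal's rule, in the shape produced when the product rule acts on an exponential times a
binomial sum. -/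
theorem sum_choose_succ (n : ℕ) (f : ℕ → ℝ) :
    ∑ ν ∈ Finset.range (n + 2), ((n + 1).choose ν : ℝ) * f ν =
      ∑ ν ∈ Finset.range (n + 1), (n.choose ν : ℝ) * (f ν + f (ν + 1)) := by
  rw [Finset.sum_choose_succ_mul (fun i _ => f i) n, ← Finset.sum_add_distrib]
  exact Finset.sum_congr rfl fun ν _ => (mul_add _ _ _).symm

/-- Follows from `(ν+1) C(n,ν+1) = (n-ν) C(n,ν)`; it absorbs the factor `ν` created by
differentiating `a ^ (2ν)`. -/
theorem sum_choose_mul_index (n : ℕ) (f : ℕ → ℝ) :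
    ∑ ν ∈ Finset.range (n + 1), (n.choose ν : ℝ) * (ν * f ν) =
      ∑ ν ∈ Finset.range (n + 1), (n.choose ν : ℝ) * ((n - ν) * f (ν + 1)) := by
  rw [Finset.sum_range_succ', Finset.sum_range_succ]
  simp only [Nat.cast_zero, zero_mul, mul_zero, add_zero, sub_self]
  refine Finset.sum_congr rfl fun ν hν => ?_
  have h := n.choose_succ_right_eq ν
  have h' : (n.choose (ν + 1) : ℝ) * (ν + 1) = n.choose ν * (n - ν) := by
    rw [← Nat.cast_sub (Finset.mem_range.1 hν).le]
    exact_mod_cast h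
  push_cast
  linear_combination f (ν + 1) * h'

theorem hasDerivAt_bessel_right (ν : ℕ) (a s : ℝ) :
    HasDerivAt (fun s => bessel ν (a ^ 2 * s)) (-(1 / 2) * a ^ 2 * bessel (ν + 1) (a ^ 2 * s)) s := by
  have := (hasDerivAt_bessel ν (a ^ 2 * s)).comp s ((hasDerivAt_id s).const_mul (a ^ 2))
  exact this.congr_deriv (by ring)

theorem hasDerivAt_bessel_left (ν : ℕ) (a s : ℝ) :
    HasDerivAt (fun a => bessel ν (a ^ 2 * s)) (-(a * s) * bessel (ν + 1) (a ^ 2 * s)) a := by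
  have := (hasDerivAt_bessel ν (a ^ 2 * s)).comp a ((hasDerivAt_pow 2 a).mul_const s)
  exact this.congr_deriv (by push_cast; ring)

theorem hasDerivAt_exp_right (a s : ℝ) : HasDerivAt (fun s => Real.exp ((a ^ 2 - s) / 2))
    (-(1 / 2) * Real.exp ((a ^ 2 - s) / 2)) s := by
  have := (((hasDerivAt_id s).const_sub (a ^ 2)).div_const 2).exp
  exact this.congr_deriv (by simp only [id]; ring)

theorem hasDerivAt_exp_left (a s : ℝ) : HasDerivAt (fun a => Real.exp ((a ^ 2 - s) / 2))
    (a * Real.exp ((a ^ 2 - s) / 2)) a := by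
  have := (((hasDerivAt_pow 2 a).sub_const s).div_const 2).exp
  exact this.congr_deriv (by push_cast; ring)

/-- The exponential reproduces the `ν`-th term and the Bessel factor yields the `(ν+1)`-st, both
with factor `-1/2`; Pascal's rule merges them. The `1/2` reflects `(1/r)∂_r = 2∂_s`. -/
theorem hasDerivAt_evenPart_right (n : ℕ) (a s : ℝ) :
    HasDerivAt (evenPart n a) (1 / 2 * evenPart (n + 1) a s) s := by
  have h := ((hasDerivAt_exp_right a s).const_mul ((-1) ^ n)).mul
    (HasDerivAt.fun_sum (u := Finset.range (n + 1)) fun ν _ =>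
      ((hasDerivAt_bessel_right ν a s).const_mul (a ^ (2 * ν))).const_mul (n.choose ν : ℝ))
  refine h.congr_deriv ?_
  rw [evenPart, sum_choose_succ]
  simp only [mul_add, Finset.sum_add_distrib]
  rw [pow_succ (-1 : ℝ)]
  have e : ∑ ν ∈ Finset.range (n + 1), (n.choose ν : ℝ) *
      (a ^ (2 * ν) * (-(1 / 2) * a ^ 2 * bessel (ν + 1) (a ^ 2 * s))) =
      -(1 / 2) * ∑ ν ∈ Finset.range (n + 1), (n.choose ν : ℝ) *
        (a ^ (2 * ν + 2 * 1) * bessel (ν + 1) (a ^ 2 * s)) := by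
    rw [Finset.mul_sum]
    exact Finset.sum_congr rfl fun ν _ => by ring
  rw [e]
  ring

theorem hasDerivAt_oddPart_right (n : ℕ) (a s : ℝ) :
    HasDerivAt (oddPart n a) (1 / 2 * oddPart (n + 1) a s) s := by
  have h := ((hasDerivAt_exp_right a s).const_mul ((-1) ^ n)).mul
    (HasDerivAt.fun_sum (u := Finset.range (n + 1)) fun ν _ =>
      ((hasDerivAt_bessel_right (ν + 1) a s).const_mul (a ^ (2 * ν + 1))).const_mul
        (n.choose ν : ℝ))
  refine h.congr_deriv ?_
  rw [oddPart, sum_choose_succ]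
  simp only [mul_add, Finset.sum_add_distrib]
  rw [pow_succ (-1 : ℝ)]
  have e : ∑ ν ∈ Finset.range (n + 1), (n.choose ν : ℝ) *
      (a ^ (2 * ν + 1) * (-(1 / 2) * a ^ 2 * bessel (ν + 1 + 1) (a ^ 2 * s))) =
      -(1 / 2) * ∑ ν ∈ Finset.range (n + 1), (n.choose ν : ℝ) *
        (a ^ (2 * ν + 2 * 1 + 1) * bessel (ν + 1 + 1) (a ^ 2 * s)) := by
    rw [Finset.mul_sum]
    exact Finset.sum_congr rfl fun ν _ => by ring
  rw [e]
  ring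

/-- This is `∂_a v = -∂_r u`, divided by `r` and acted on by `(2∂_s)^n`. Here it is checked term by
term with the Bessel recurrence. -/
theorem hasDerivAt_oddPart_left (n : ℕ) (a s : ℝ) :
    HasDerivAt (fun a => oddPart n a s) (-evenPart (n + 1) a s) a := by
  have h := ((hasDerivAt_exp_left a s).const_mul ((-1) ^ n)).mul
    (HasDerivAt.fun_sum (u := Finset.range (n + 1)) fun ν _ =>
      ((hasDerivAt_pow (2 * ν + 1) a).fun_mul (hasDerivAt_bessel_left (ν + 1) a s)).const_mul
        (n.choose ν : ℝ))
  refine h.congr_deriv ?_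
  rw [evenPart, sum_choose_succ]
  have e : ∑ ν ∈ Finset.range (n + 1), (n.choose ν : ℝ) *
        (a ^ (2 * ν) * bessel ν (a ^ 2 * s) +
          a ^ (2 * (ν + 1)) * bessel (ν + 1) (a ^ 2 * s)) =
      a * ∑ ν ∈ Finset.range (n + 1), (n.choose ν : ℝ) *
        (a ^ (2 * ν + 1) * bessel (ν + 1) (a ^ 2 * s)) +
      ∑ ν ∈ Finset.range (n + 1), (n.choose ν : ℝ) *
        (((2 * ν + 1 : ℕ) : ℝ) * a ^ (2 * ν + 1 - 1) * bessel (ν + 1) (a ^ 2 * s) +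
          a ^ (2 * ν + 1) * (-(a * s) * bessel (ν + 1 + 1) (a ^ 2 * s))) := by
    rw [Finset.mul_sum, ← Finset.sum_add_distrib]
    refine Finset.sum_congr rfl fun ν _ => ?_
    have hr := mul_bessel_add_two ν (a ^ 2 * s)
    rw [Nat.add_sub_cancel]
    push_cast
    linear_combination (n.choose ν : ℝ) * a ^ (2 * ν) * hr
  rw [e, pow_succ (-1 : ℝ)]
  ring

/-- This is `∂_a u = ∂_r v = v₀ + s v₁`; each of the `n` operators `2∂_s` contributes `2` by hitting
the factor `s`, whence `2n + 1`. -/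
theorem hasDerivAt_evenPart_left (n : ℕ) (a s : ℝ) :
    HasDerivAt (fun a => evenPart n a s)
      ((2 * n + 1) * oddPart n a s + s * oddPart (n + 1) a s) a := by
  have h := ((hasDerivAt_exp_left a s).const_mul ((-1) ^ n)).mul
    (HasDerivAt.fun_sum (u := Finset.range (n + 1)) fun ν _ =>
      ((hasDerivAt_pow (2 * ν) a).fun_mul (hasDerivAt_bessel_left ν a s)).const_mul
        (n.choose ν : ℝ))
  refine h.congr_deriv ?_
  rw [oddPart, oddPart, sum_choose_succ, pow_succ (-1 : ℝ)]
  -- The truncated exponent at `ν = 0` is harmless, since that term carries the factor `ν`; after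
  -- the shift the exponent is `2ν + 1`.
  have e1 := sum_choose_mul_index n fun ν => 2 * a ^ (2 * ν - 1) * bessel ν (a ^ 2 * s)
  have e2 : a * ∑ ν ∈ Finset.range (n + 1), (n.choose ν : ℝ) *
        (a ^ (2 * ν) * bessel ν (a ^ 2 * s)) +
      ∑ ν ∈ Finset.range (n + 1), (n.choose ν : ℝ) *
        (((2 * ν : ℕ) : ℝ) * a ^ (2 * ν - 1) * bessel ν (a ^ 2 * s) +
          a ^ (2 * ν) * (-(a * s) * bessel (ν + 1) (a ^ 2 * s))) =
      (2 * n + 1) * ∑ ν ∈ Finset.range (n + 1), (n.choose ν : ℝ) *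
        (a ^ (2 * ν + 1) * bessel (ν + 1) (a ^ 2 * s)) -
      s * ∑ ν ∈ Finset.range (n + 1), (n.choose ν : ℝ) *
        (a ^ (2 * ν + 1) * bessel (ν + 1) (a ^ 2 * s) +
          a ^ (2 * (ν + 1) + 1) * bessel (ν + 1 + 1) (a ^ 2 * s)) := by
    have e3 : ∑ ν ∈ Finset.range (n + 1), (n.choose ν : ℝ) *
        (((2 * ν : ℕ) : ℝ) * a ^ (2 * ν - 1) * bessel ν (a ^ 2 * s) +
          a ^ (2 * ν) * (-(a * s) * bessel (ν + 1) (a ^ 2 * s))) =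
        ∑ ν ∈ Finset.range (n + 1), (n.choose ν : ℝ) *
          (ν * (2 * a ^ (2 * ν - 1) * bessel ν (a ^ 2 * s))) +
        ∑ ν ∈ Finset.range (n + 1), (n.choose ν : ℝ) *
          (a ^ (2 * ν) * (-(a * s) * bessel (ν + 1) (a ^ 2 * s))) := by
      rw [← Finset.sum_add_distrib]
      exact Finset.sum_congr rfl fun ν _ => by push_cast; ring
    rw [e3, e1, Finset.mul_sum, Finset.mul_sum, Finset.mul_sum, ← Finset.sum_add_distrib,
      ← Finset.sum_add_distrib, ← Finset.sum_sub_distrib]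
    refine Finset.sum_congr rfl fun ν _ => ?_
    have hr := mul_bessel_add_two ν (a ^ 2 * s)
    rw [show 2 * (ν + 1) - 1 = 2 * ν + 1 by omega]
    linear_combination (n.choose ν : ℝ) * a ^ (2 * ν + 1) * hr
  linear_combination (-1) ^ n * Real.exp ((a ^ 2 - s) / 2) * e2

theorem realEntire_evenPart (n : ℕ) (s : ℝ) : RealEntire fun a => evenPart n a s := by
  refine ⟨fun a => (-1) ^ n * Complex.exp ((a ^ 2 - s) / 2) * ∑ ν ∈ Finset.range (n + 1),
    (n.choose ν : ℂ) * (a ^ (2 * ν) * cbessel ν (a ^ 2 * s)), ?_, fun t => ?_⟩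
  · have := differentiable_cbessel
    fun_prop
  · simp [evenPart, ofReal_bessel]

theorem realEntire_oddPart (n : ℕ) (s : ℝ) : RealEntire fun a => oddPart n a s := by
  refine ⟨fun a => (-1) ^ n * Complex.exp ((a ^ 2 - s) / 2) * ∑ ν ∈ Finset.range (n + 1),
    (n.choose ν : ℂ) * (a ^ (2 * ν + 1) * cbessel (ν + 1) (a ^ 2 * s)), ?_, fun t => ?_⟩
  · have := differentiable_cbessel
    fun_prop
  · simp [oddPart, ofReal_bessel]

theorem contDiff_evenPart {E : Type*} [NormedAddCommGroup E] [NormedSpace ℝ E]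
    {k : WithTop ℕ∞} {f g : E → ℝ} (hf : ContDiff ℝ k f) (hg : ContDiff ℝ k g) (n : ℕ) :
    ContDiff ℝ k fun x => evenPart n (f x) (g x) := by
  unfold evenPart
  have h := fun ν => (contDiff_bessel ν (k := k)).comp ((hf.pow 2).mul hg)
  simp only [Function.comp_def] at h
  fun_prop

theorem contDiff_oddPart {E : Type*} [NormedAddCommGroup E] [NormedSpace ℝ E]
    {k : WithTop ℕ∞} {f g : E → ℝ} (hf : ContDiff ℝ k f) (hg : ContDiff ℝ k g) (n : ℕ) :
    ContDiff ℝ k fun x => oddPart n (f x) (g x) := by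
  unfold oddPart
  have h := fun ν => (contDiff_bessel ν (k := k)).comp ((hf.pow 2).mul hg)
  simp only [Function.comp_def] at h
  fun_prop

variable {m : ℕ}

/-! ### Vectors in the Clifford algebra -/

instance finiteDimensional_Cl (m : ℕ) : FiniteDimensional ℝ (Cl m) :=
  (clBasis m).finiteDimensional_of_finite

/-- `vec` as a continuous linear map. -/
def vecCLM (m : ℕ) : EuclideanSpace ℝ (Fin m) →L[ℝ] Cl m :=
  LinearMap.toContinuousLinearMap
    ((CliffordAlgebra.ι (negSq m)).comp (WithLp.linearEquiv 2 ℝ (Fin m → ℝ)).toLinearMap)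

theorem vecCLM_apply (x : EuclideanSpace ℝ (Fin m)) : vecCLM m x = vec x := rfl

/-- `algebraMap` as a continuous linear map. -/
def scalarCLM (m : ℕ) : ℝ →L[ℝ] Cl m :=
  LinearMap.toContinuousLinearMap (Algebra.linearMap ℝ (Cl m))

theorem scalarCLM_apply (c : ℝ) : scalarCLM m c = algebraMap ℝ (Cl m) c := rfl

/-- `under` as a continuous linear map. -/
def underCLM (m : ℕ) : EuclideanSpace ℝ (Fin (m + 1)) →L[ℝ] EuclideanSpace ℝ (Fin m) :=
  LinearMap.toContinuousLinearMap
    { toFun := under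
      map_add' := fun _ _ => rfl
      map_smul' := fun _ _ => rfl }

theorem underCLM_apply (x : EuclideanSpace ℝ (Fin (m + 1))) : underCLM m x = under x := rfl

theorem vec_single (j : Fin m) : vec (EuclideanSpace.single j 1) = e m j := by
  simp only [vec, e]
  congr 1

theorem sum_smul_e (x : EuclideanSpace ℝ (Fin m)) : ∑ j, x j • e m j = vec x := by
  simp only [← vec_single, ← vecCLM_apply, ← map_smul, ← map_sum]
  congr 1
  ext i
  simp [Finset.sum_apply, Pi.single_apply]

theorem vec_mul_vec (x : EuclideanSpace ℝ (Fin m)) :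
    vec x * vec x = algebraMap ℝ (Cl m) (-‖x‖ ^ 2) := by
  rw [vec, CliffordAlgebra.ι_sq_scalar, EuclideanSpace.real_norm_sq_eq]
  simp [QuadraticMap.weightedSumSquares_apply, pow_two]

theorem e_mul_e (j : Fin m) : e m j * e m j = -1 := by
  rw [← vec_single, vec_mul_vec]
  simp

theorem under_single_zero : under (EuclideanSpace.single (0 : Fin (m + 1)) (1 : ℝ)) = 0 := by
  ext i
  simp [under]

theorem under_single_succ (j : Fin m) :
    under (EuclideanSpace.single j.succ (1 : ℝ)) = EuclideanSpace.single j 1 := by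
  ext i
  simp [under]

theorem norm_add_smul_single_sq (x : EuclideanSpace ℝ (Fin m)) (j : Fin m) (t : ℝ) :
    ‖x + t • EuclideanSpace.single j (1 : ℝ)‖ ^ 2 = ‖x‖ ^ 2 + 2 * x j * t + t ^ 2 := by
  rw [norm_add_sq_real, norm_smul, inner_smul_right, EuclideanSpace.inner_single_right]
  simp
  ring

/-! ### Axial functions and their partial derivatives -/

/-- The function `g(x₀, |x̲|²)`. -/
def radial (g : ℝ → ℝ → ℝ) (x : EuclideanSpace ℝ (Fin (m + 1))) : ℝ := g (x 0) (‖under x‖ ^ 2)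

theorem hasLineDerivAt_radial_zero {g : ℝ → ℝ → ℝ} {g' : ℝ} {x : EuclideanSpace ℝ (Fin (m + 1))}
    (h : HasDerivAt (fun a => g a (‖under x‖ ^ 2)) g' (x 0)) :
    HasLineDerivAt ℝ (radial g) g' x (EuclideanSpace.single 0 1) := by
  have h1 : HasDerivAt (fun t : ℝ => x 0 + t) 1 0 := (hasDerivAt_id 0).const_add _
  have h2 := HasDerivAt.comp (0 : ℝ) (by simpa using h) h1
  rw [mul_one] at h2
  refine h2.congr_of_eventuallyEq (Filter.Eventually.of_forall fun t => ?_)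
  have h3 : under (x + t • EuclideanSpace.single (0 : Fin (m + 1)) (1 : ℝ)) = under x := by
    rw [← underCLM_apply, map_add, map_smul, underCLM_apply, underCLM_apply, under_single_zero]
    simp
  simp [radial, h3]

theorem hasLineDerivAt_radial_succ {g : ℝ → ℝ → ℝ} {g' : ℝ} {x : EuclideanSpace ℝ (Fin (m + 1))}
    (h : HasDerivAt (g (x 0)) (1 / 2 * g') (‖under x‖ ^ 2)) (j : Fin m) :
    HasLineDerivAt ℝ (radial g) (x j.succ * g') x (EuclideanSpace.single j.succ 1) := by
  have h1 : HasDerivAt (fun t : ℝ => ‖under x‖ ^ 2 + 2 * x j.succ * t + t ^ 2)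
      (2 * x j.succ) 0 := by
    have := (((hasDerivAt_id (0 : ℝ)).const_mul (2 * x j.succ)).const_add (‖under x‖ ^ 2)).add
      (hasDerivAt_pow 2 (0 : ℝ))
    exact this.congr_deriv (by simp)
  have h2 := HasDerivAt.comp (0 : ℝ) (by simpa using h) h1
  refine (h2.congr_deriv (by ring)).congr_of_eventuallyEq (Filter.Eventually.of_forall fun t => ?_)
  have h3 : ‖under (x + t • EuclideanSpace.single j.succ (1 : ℝ))‖ ^ 2 =
      ‖under x‖ ^ 2 + 2 * x j.succ * t + t ^ 2 := by
    rw [← underCLM_apply, map_add, map_smul, underCLM_apply, underCLM_apply, under_single_succ,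
      norm_add_smul_single_sq]
    rfl
  have h4 : (x + t • EuclideanSpace.single j.succ (1 : ℝ)) 0 = x 0 := by
    simp [Fin.succ_ne_zero]
  simp only [radial, h3, h4, Function.comp]

/-- The function `((1/r) ∂_r)^n u + x̲ ((1/r) ∂_r)^n (v / r)` for `exp (z² / 2) = u + i v`. It is
proportional to `Δ^n` of the axial lift of `exp (z² / 2)`, and monogenic for `m = 2 n + 1`. -/
def axial (n : ℕ) (x : EuclideanSpace ℝ (Fin (m + 1))) : Cl m :=
  algebraMap ℝ (Cl m) (radial (evenPart n) x) + radial (oddPart n) x • vec (under x)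

theorem contDiff_radial_evenPart (n : ℕ) {k : WithTop ℕ∞} :
    ContDiff ℝ k (radial (m := m) (evenPart n)) :=
  contDiff_evenPart (EuclideanSpace.proj (𝕜 := ℝ) (0 : Fin (m + 1))).contDiff
    ((underCLM m).contDiff.norm_sq ℝ) n

theorem contDiff_radial_oddPart (n : ℕ) {k : WithTop ℕ∞} :
    ContDiff ℝ k (radial (m := m) (oddPart n)) :=
  contDiff_oddPart (EuclideanSpace.proj (𝕜 := ℝ) (0 : Fin (m + 1))).contDiff
    ((underCLM m).contDiff.norm_sq ℝ) n

theorem contDiff_axial (n : ℕ) {k : WithTop ℕ∞} : ContDiff ℝ k (axial (m := m) n) :=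
  ((scalarCLM m).contDiff.comp (contDiff_radial_evenPart n)).add
    ((contDiff_radial_oddPart n).smul ((vecCLM m).contDiff.comp (underCLM m).contDiff))

theorem hasLineDerivAt_scalar_add_smul_vec {f g : EuclideanSpace ℝ (Fin (m + 1)) → ℝ} {f' g' : ℝ}
    {x v : EuclideanSpace ℝ (Fin (m + 1))} (hf : HasLineDerivAt ℝ f f' x v)
    (hg : HasLineDerivAt ℝ g g' x v) :
    HasLineDerivAt ℝ (fun y => algebraMap ℝ (Cl m) (f y) + g y • vec (under y))
      (algebraMap ℝ (Cl m) f' + g' • vec (under x) + g x • vec (under v)) x v := by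
  have h1 : HasDerivAt (fun t : ℝ => vec (under (x + t • v))) (vec (under v)) 0 := by
    have h := (((hasDerivAt_id (0 : ℝ)).smul_const v).const_add x)
    have := ((vecCLM m).comp (underCLM m)).hasFDerivAt.comp_hasDerivAt (0 : ℝ) h
    rw [one_smul] at this
    exact this
  have h2 := ((scalarCLM m).hasFDerivAt.comp_hasDerivAt (0 : ℝ) hf).add (HasDerivAt.fun_smul hg h1)
  refine h2.congr_deriv ?_
  simp only [zero_smul, add_zero, scalarCLM_apply]
  abel

theorem hasLineDerivAt_axial_zero (n : ℕ) (x : EuclideanSpace ℝ (Fin (m + 1))) :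
    HasLineDerivAt ℝ (axial n)
      (algebraMap ℝ (Cl m) ((2 * n + 1) * radial (oddPart n) x +
        ‖under x‖ ^ 2 * radial (oddPart (n + 1)) x) -
        radial (evenPart (n + 1)) x • vec (under x)) x (EuclideanSpace.single 0 1) := by
  have h := hasLineDerivAt_scalar_add_smul_vec
    (hasLineDerivAt_radial_zero (hasDerivAt_evenPart_left n (x 0) (‖under x‖ ^ 2)))
    (hasLineDerivAt_radial_zero (hasDerivAt_oddPart_left n (x 0) (‖under x‖ ^ 2)))
  rw [under_single_zero, ← vecCLM_apply (0 : EuclideanSpace ℝ (Fin m)), map_zero, smul_zero,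
    add_zero, neg_smul, ← sub_eq_add_neg] at h
  exact h

theorem hasLineDerivAt_axial_succ (n : ℕ) (x : EuclideanSpace ℝ (Fin (m + 1))) (j : Fin m) :
    HasLineDerivAt ℝ (axial n) (x j.succ • axial (n + 1) x + radial (oddPart n) x • e m j) x
      (EuclideanSpace.single j.succ 1) := by
  have h := hasLineDerivAt_scalar_add_smul_vec
    (hasLineDerivAt_radial_succ (hasDerivAt_evenPart_right n (x 0) (‖under x‖ ^ 2)) j)
    (hasLineDerivAt_radial_succ (hasDerivAt_oddPart_right n (x 0) (‖under x‖ ^ 2)) j)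
  rw [under_single_succ, vec_single] at h
  refine HasDerivAt.congr_deriv h ?_
  simp only [axial, radial, Algebra.algebraMap_eq_smul_one]
  module

theorem fderiv_axial_zero (n : ℕ) (x : EuclideanSpace ℝ (Fin (m + 1))) :
    fderiv ℝ (axial n) x (EuclideanSpace.single 0 1) =
      algebraMap ℝ (Cl m) ((2 * n + 1) * radial (oddPart n) x +
        ‖under x‖ ^ 2 * radial (oddPart (n + 1)) x) -
        radial (evenPart (n + 1)) x • vec (under x) := by
  rw [← ((contDiff_axial n (k := 1)).differentiable one_ne_zero x).lineDeriv_eq_fderiv]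
  exact (hasLineDerivAt_axial_zero n x).lineDeriv

theorem fderiv_axial_succ (n : ℕ) (x : EuclideanSpace ℝ (Fin (m + 1))) (j : Fin m) :
    fderiv ℝ (axial n) x (EuclideanSpace.single j.succ 1) =
      x j.succ • axial (n + 1) x + radial (oddPart n) x • e m j := by
  rw [← ((contDiff_axial n (k := 1)).differentiable one_ne_zero x).lineDeriv_eq_fderiv]
  exact (hasLineDerivAt_axial_succ n x j).lineDeriv

/-- The Dirac part is `x̲ A_{n+1} - m v_n`, the `-m` coming from `∑ e_j²`. As `x̲² = -s`, the term
`x̲ A_{n+1}` cancels everything in `∂_{x₀} A_n` except `(2n+1) v_n`. -/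
theorem cauchyRiemann_axial (n : ℕ) (x : EuclideanSpace ℝ (Fin (m + 1))) :
    cauchyRiemann (axial n) x =
      algebraMap ℝ (Cl m) ((2 * n + 1 - m) * radial (oddPart n) x) := by
  have h : ∑ j : Fin m, e m j * fderiv ℝ (axial n) x (EuclideanSpace.single j.succ 1) =
      vec (under x) * axial (n + 1) x - algebraMap ℝ (Cl m) (m * radial (oddPart n) x) := by
    simp only [fderiv_axial_succ, mul_add, mul_smul_comm, e_mul_e, Finset.sum_add_distrib]
    rw [← sum_smul_e, Finset.sum_mul, sub_eq_add_neg]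
    congr 1
    · exact Finset.sum_congr rfl fun j _ => (smul_mul_assoc _ _ _).symm
    · rw [Finset.sum_const, Finset.card_univ, Fintype.card_fin, Algebra.algebraMap_eq_smul_one,
        mul_smul, smul_neg, smul_neg, Nat.cast_smul_eq_nsmul]
  rw [cauchyRiemann, h, fderiv_axial_zero, axial, mul_add, mul_smul_comm, vec_mul_vec,
    ← Algebra.commutes, ← Algebra.smul_def]
  simp only [Algebra.algebraMap_eq_smul_one, smul_smul]
  module

/-! ### The Laplacian of axial functions -/

theorem fderiv_fderiv_apply {E F : Type*} [NormedAddCommGroup E] [NormedSpace ℝ E]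
    [NormedAddCommGroup F] [NormedSpace ℝ F] {f : E → F} (hf : ContDiff ℝ 2 f) (x v w : E) :
    fderiv ℝ (fderiv ℝ f) x v w = fderiv ℝ (fun y => fderiv ℝ f y w) x v := by
  have h : DifferentiableAt ℝ (fderiv ℝ f) x :=
    (hf.fderiv_right (m := 1) (by norm_num)).differentiable one_ne_zero x
  rw [fderiv_clm_apply h (differentiableAt_const w)]
  simp

theorem laplacian_eq_sum_fderiv {k : ℕ} {F : Type*} [NormedAddCommGroup F] [NormedSpace ℝ F]
    {f : EuclideanSpace ℝ (Fin k) → F} (hf : ContDiff ℝ 2 f) (x : EuclideanSpace ℝ (Fin k)) :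
    Laplacian.laplacian f x = ∑ i, fderiv ℝ (fun y => fderiv ℝ f y (EuclideanSpace.single i 1)) x
      (EuclideanSpace.single i 1) := by
  rw [InnerProductSpace.laplacian_eq_iteratedFDeriv_orthonormalBasis f
    (EuclideanSpace.basisFun (Fin k) ℝ)]
  refine Finset.sum_congr rfl fun i _ => ?_
  rw [iteratedFDeriv_two_apply, ← fderiv_fderiv_apply hf]
  simp

theorem fderiv_fderiv_axial_zero (n : ℕ) (x : EuclideanSpace ℝ (Fin (m + 1))) :
    fderiv ℝ (fun y => fderiv ℝ (axial (m := m) n) y (EuclideanSpace.single 0 1)) x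
      (EuclideanSpace.single 0 1) =
    -((2 * n + 1 : ℝ) • axial (n + 1) x + ‖under x‖ ^ 2 • axial (n + 2) x +
      (2 * radial (oddPart (n + 1)) x) • vec (under x)) := by
  have hd : DifferentiableAt ℝ
      (fun y => fderiv ℝ (axial (m := m) n) y (EuclideanSpace.single 0 1)) x :=
    (((contDiff_axial n).fderiv_right (m := 1) (n := 2) (by norm_num)).clm_apply
      contDiff_const).differentiable one_ne_zero x
  rw [← hd.lineDeriv_eq_fderiv]
  refine HasLineDerivAt.lineDeriv ?_
  simp only [fderiv_axial_zero, sub_eq_add_neg, ← neg_smul]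
  have h1 := hasLineDerivAt_radial_zero
    (g := fun a s => (2 * n + 1) * oddPart n a s + s * oddPart (n + 1) a s) (x := x)
    (((hasDerivAt_oddPart_left n (x 0) (‖under x‖ ^ 2)).const_mul (2 * (n : ℝ) + 1)).add
      ((hasDerivAt_oddPart_left (n + 1) (x 0) (‖under x‖ ^ 2)).const_mul (‖under x‖ ^ 2)))
  have h2 := hasLineDerivAt_radial_zero (g := fun a s => -evenPart (n + 1) a s) (x := x)
    (hasDerivAt_evenPart_left (n + 1) (x 0) (‖under x‖ ^ 2)).neg
  have h := hasLineDerivAt_scalar_add_smul_vec h1 h2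
  refine HasDerivAt.congr_deriv h ?_
  rw [under_single_zero, ← vecCLM_apply (0 : EuclideanSpace ℝ (Fin m)), map_zero, smul_zero,
    add_zero, axial, axial]
  simp only [Algebra.algebraMap_eq_smul_one, radial]
  push_cast
  module

theorem fderiv_fderiv_axial_succ (n : ℕ) (x : EuclideanSpace ℝ (Fin (m + 1))) (j : Fin m) :
    fderiv ℝ (fun y => fderiv ℝ (axial (m := m) n) y (EuclideanSpace.single j.succ 1)) x
      (EuclideanSpace.single j.succ 1) =
    axial (n + 1) x + x j.succ ^ 2 • axial (n + 2) x +
      (2 * radial (oddPart (n + 1)) x) • (x j.succ • e m j) := by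
  have hd : DifferentiableAt ℝ
      (fun y => fderiv ℝ (axial (m := m) n) y (EuclideanSpace.single j.succ 1)) x :=
    (((contDiff_axial n).fderiv_right (m := 1) (n := 2) (by norm_num)).clm_apply
      contDiff_const).differentiable one_ne_zero x
  rw [← hd.lineDeriv_eq_fderiv]
  refine HasLineDerivAt.lineDeriv ?_
  simp only [fderiv_axial_succ]
  have h0 : HasLineDerivAt ℝ (fun y : EuclideanSpace ℝ (Fin (m + 1)) => y j.succ) 1 x
      (EuclideanSpace.single j.succ 1) := by
    have := (hasDerivAt_id (0 : ℝ)).const_add (x j.succ)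
    simpa [HasLineDerivAt] using this
  have h1 := HasDerivAt.fun_smul h0 (hasLineDerivAt_axial_succ (n + 1) x j)
  have h2 := HasDerivAt.smul_const
    (hasLineDerivAt_radial_succ (hasDerivAt_oddPart_right n (x 0) (‖under x‖ ^ 2)) j) (e m j)
  refine HasDerivAt.congr_deriv (h1.add h2) ?_
  simp only [zero_smul, add_zero, radial]
  module

/-- Summing the second derivatives in `x̲` gives `m A_{n+1} + s A_{n+2} + 2 v_{n+1} x̲`; the second
`x₀`-derivative removes the last two terms and subtracts `(2n+1) A_{n+1}`. -/
theorem laplacian_axial (n : ℕ) :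
    Laplacian.laplacian (axial (m := m) n) = ((m : ℝ) - 1 - 2 * n) • axial (n + 1) := by
  funext x
  rw [laplacian_eq_sum_fderiv (contDiff_axial n), Fin.sum_univ_succ, fderiv_fderiv_axial_zero]
  simp only [fderiv_fderiv_axial_succ, Finset.sum_add_distrib, ← Finset.smul_sum,
    ← Finset.sum_smul]
  have h1 : ∑ j : Fin m, x j.succ • e m j = vec (under x) := sum_smul_e (under x)
  have h2 : ∑ j : Fin m, x j.succ ^ 2 = ‖under x‖ ^ 2 :=
    (EuclideanSpace.real_norm_sq_eq (under x)).symm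
  rw [h1, h2, Finset.sum_const, Finset.card_univ, Fintype.card_fin, ← Nat.cast_smul_eq_nsmul ℝ,
    Pi.smul_apply]
  module

theorem laplacian_smul_axial (c : ℝ) (n : ℕ) :
    Laplacian.laplacian (c • axial (m := m) n) = (c * ((m : ℝ) - 1 - 2 * n)) • axial (n + 1) := by
  funext x
  rw [InnerProductSpace.laplacian_smul c (contDiff_axial n).contDiffAt, laplacian_axial]
  simp [smul_smul]

theorem iterate_laplacian_axial (n : ℕ) :
    (fun g : EuclideanSpace ℝ (Fin (m + 1)) → Cl m => Laplacian.laplacian g)^[n] (axial 0) =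
      (∏ k ∈ Finset.range n, ((m : ℝ) - 1 - 2 * k)) • axial n := by
  induction n with
  | zero => simp
  | succ n ih =>
    rw [Function.iterate_succ_apply', ih, laplacian_smul_axial, Finset.prod_range_succ]

/-! ### The Cauchy-Kowalevski series of a monogenic function -/

/-- `atZero` as a continuous linear map. -/
def atZeroCLM (m : ℕ) : EuclideanSpace ℝ (Fin m) →L[ℝ] EuclideanSpace ℝ (Fin (m + 1)) :=
  LinearMap.toContinuousLinearMap
    { toFun := atZero
      map_add' := fun _ _ => by ext i; refine Fin.cases ?_ (fun _ => ?_) i <;> simp [atZero]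
      map_smul' := fun _ _ => by ext i; refine Fin.cases ?_ (fun _ => ?_) i <;> simp [atZero] }

theorem atZero_single (j : Fin m) :
    atZero (EuclideanSpace.single j (1 : ℝ)) = EuclideanSpace.single j.succ 1 := by
  ext i
  refine Fin.cases ?_ (fun k => ?_) i
  · simp [atZero, (Fin.succ_ne_zero j).symm]
  · simp [atZero]

theorem atZero_zero (x : EuclideanSpace ℝ (Fin m)) : atZero x 0 = 0 := rfl

theorem under_atZero (x : EuclideanSpace ℝ (Fin m)) : under (atZero x) = x := rfl

/-- The partial derivative `∂_{x₀}`. -/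
def partialZero (F : EuclideanSpace ℝ (Fin (m + 1)) → Cl m) (x : EuclideanSpace ℝ (Fin (m + 1))) :
    Cl m :=
  fderiv ℝ F x (EuclideanSpace.single 0 1)

open scoped ContDiff in
theorem contDiff_partialZero {F : EuclideanSpace ℝ (Fin (m + 1)) → Cl m} (hF : ContDiff ℝ ∞ F) :
    ContDiff ℝ ∞ (partialZero F) :=
  (hF.fderiv_right (m := ∞) le_rfl).clm_apply contDiff_const

open scoped ContDiff in
theorem contDiff_iterate_partialZero {F : EuclideanSpace ℝ (Fin (m + 1)) → Cl m}
    (hF : ContDiff ℝ ∞ F) (n : ℕ) : ContDiff ℝ ∞ (partialZero^[n] F) := by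
  induction n with
  | zero => exact hF
  | succ n ih =>
    rw [Function.iterate_succ_apply']
    exact contDiff_partialZero ih

theorem fderiv_partialZero {F : EuclideanSpace ℝ (Fin (m + 1)) → Cl m} (hF : ContDiff ℝ 2 F)
    (x v : EuclideanSpace ℝ (Fin (m + 1))) :
    fderiv ℝ (partialZero F) x v = partialZero (fun y => fderiv ℝ F y v) x := by
  unfold partialZero
  rw [← fderiv_fderiv_apply hF, ← fderiv_fderiv_apply hF]
  exact (hF.contDiffAt.isSymmSndFDerivAt (by simp)).eq _ _

theorem cauchyRiemann_partialZero {F : EuclideanSpace ℝ (Fin (m + 1)) → Cl m}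
    (hF : ContDiff ℝ 2 F) : cauchyRiemann (partialZero F) = partialZero (cauchyRiemann F) := by
  funext x
  have hd : ∀ v, DifferentiableAt ℝ (fun y => fderiv ℝ F y v) x := fun v =>
    ((hF.fderiv_right (m := 1) (by norm_num)).clm_apply
      contDiff_const).differentiable one_ne_zero x
  have h : HasFDerivAt (cauchyRiemann F) _ x := (hd (EuclideanSpace.single 0 1)).hasFDerivAt.add
    (HasFDerivAt.fun_sum (u := Finset.univ) fun j _ =>
      (LinearMap.toContinuousLinearMap (LinearMap.mulLeft ℝ (e m j))).hasFDerivAt.comp x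
        (hd (EuclideanSpace.single j.succ 1)).hasFDerivAt)
  rw [partialZero, h.fderiv]
  simp [cauchyRiemann, fderiv_partialZero hF, partialZero]

theorem dirac_comp_atZero {F : EuclideanSpace ℝ (Fin (m + 1)) → Cl m} (hF : Differentiable ℝ F)
    (hc : ∀ x, cauchyRiemann F x = 0) :
    dirac (F ∘ atZero) = -(partialZero F ∘ atZero) := by
  funext x
  have h : ∀ v, fderiv ℝ (F ∘ atZero) x v = fderiv ℝ F (atZero x) (atZero v) := fun v => by
    have := ((hF (atZero x)).hasFDerivAt).comp x (atZeroCLM m).hasFDerivAt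
    exact congrArg (fun L => L v) this.fderiv
  simp only [dirac, h, atZero_single]
  exact eq_neg_of_add_eq_zero_right (hc (atZero x))

theorem dirac_const_smul (c : ℝ) {f : EuclideanSpace ℝ (Fin m) → Cl m} (hf : Differentiable ℝ f) :
    dirac (c • f) = c • dirac f := by
  funext x
  simp only [dirac, fderiv_const_smul (hf x), Pi.smul_apply, Finset.smul_sum,
    smul_apply, mul_smul_comm]

open scoped ContDiff in
-- Since `∂_{x₀}` commutes with the Cauchy-Riemann operator, every `∂_{x₀}^n F` is again annihilated
-- by it, and `dirac_comp_atZero` applies at each stage.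
theorem iterate_dirac_comp_atZero {F : EuclideanSpace ℝ (Fin (m + 1)) → Cl m}
    (hF : ContDiff ℝ ∞ F) (hc : ∀ x, cauchyRiemann F x = 0) (n : ℕ) :
    dirac^[n] (F ∘ atZero) = (-1 : ℝ) ^ n • (partialZero^[n] F ∘ atZero) := by
  have hcn : ∀ n x, cauchyRiemann (partialZero^[n] F) x = 0 := by
    intro n
    induction n with
    | zero => exact hc
    | succ n ih =>
      intro x
      rw [Function.iterate_succ_apply', cauchyRiemann_partialZero
        ((contDiff_iterate_partialZero hF n).of_le (by norm_cast)), funext ih]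
      simp [partialZero]
  induction n with
  | zero => simp
  | succ n ih =>
    have hd := (contDiff_iterate_partialZero hF n).differentiable (by simp)
    have hd' : Differentiable ℝ (partialZero^[n] F ∘ atZero) :=
      hd.comp (atZeroCLM m).differentiable
    rw [Function.iterate_succ_apply', ih, dirac_const_smul _ hd',
      dirac_comp_atZero hd (hcn n), Function.iterate_succ_apply', pow_succ, mul_smul]
    simp

open scoped ContDiff in
theorem RealEntire.contDiff {g : ℝ → ℝ} (hg : RealEntire g) : ContDiff ℝ ∞ g := by
  obtain ⟨G, hG, h⟩ := hg
  have h3 : (fun t : ℝ => (G t).re) = g := funext fun t => by rw [h, Complex.ofReal_re]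
  rw [← h3]
  exact hG.contDiff.real_of_complex

theorem RealEntire.hasDerivAt_iteratedDeriv {g : ℝ → ℝ} (hg : RealEntire g) (n : ℕ) (t : ℝ) :
    HasDerivAt (iteratedDeriv n g) (iteratedDeriv (n + 1) g t) t := by
  rw [iteratedDeriv_succ]
  exact (hg.contDiff.differentiable_iteratedDeriv n (by exact_mod_cast ENat.natCast_lt_top n)
    t).hasDerivAt

theorem RealEntire.const_mul {g : ℝ → ℝ} (hg : RealEntire g) (c : ℝ) :
    RealEntire fun t => c * g t := by
  obtain ⟨G, hG, h⟩ := hg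
  exact ⟨fun w => c * G w, hG.const_mul _, fun t => by simp [h]⟩

open scoped ContDiff in
theorem iterate_partialZero_axial {g h : ℝ → ℝ → ℝ} (hg : ∀ s, RealEntire fun a => g a s)
    (hh : ∀ s, RealEntire fun a => h a s) {F : EuclideanSpace ℝ (Fin (m + 1)) → Cl m}
    (hF : ContDiff ℝ ∞ F)
    (hF' : ∀ x, F x = algebraMap ℝ (Cl m) (radial g x) + radial h x • vec (under x)) (n : ℕ)
    (x : EuclideanSpace ℝ (Fin (m + 1))) :
    (partialZero^[n] F) x =
      algebraMap ℝ (Cl m) (radial (fun a s => iteratedDeriv n (fun a => g a s) a) x) +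
        radial (fun a s => iteratedDeriv n (fun a => h a s) a) x • vec (under x) := by
  induction n generalizing x with
  | zero => simpa using hF' x
  | succ n ih =>
    have hd := (contDiff_iterate_partialZero hF n).differentiable (by simp) x
    rw [Function.iterate_succ_apply', partialZero, ← hd.lineDeriv_eq_fderiv, funext ih]
    refine HasLineDerivAt.lineDeriv ?_
    have := hasLineDerivAt_scalar_add_smul_vec
      (hasLineDerivAt_radial_zero (x := x) (g := fun a s => iteratedDeriv n (fun a => g a s) a)
        ((hg _).hasDerivAt_iteratedDeriv n _))
      (hasLineDerivAt_radial_zero (x := x) (g := fun a s => iteratedDeriv n (fun a => h a s) a)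
        ((hh _).hasDerivAt_iteratedDeriv n _))
    rwa [under_single_zero, ← vecCLM_apply (0 : EuclideanSpace ℝ (Fin m)), map_zero, smul_zero,
      add_zero] at this

open scoped ContDiff in
/-- An axial monogenic function whose components are entire in `x₀` is the CK-extension of its
restriction to `x₀ = 0`. -/
theorem isCKExtension_of_axial {g h : ℝ → ℝ → ℝ} (hg : ∀ s, RealEntire fun a => g a s)
    (hh : ∀ s, RealEntire fun a => h a s) {F : EuclideanSpace ℝ (Fin (m + 1)) → Cl m}
    (hF : ContDiff ℝ ∞ F)
    (hF' : ∀ x, F x = algebraMap ℝ (Cl m) (radial g x) + radial h x • vec (under x))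
    (hc : ∀ x, cauchyRiemann F x = 0) : IsCKExtension (F ∘ atZero) F := by
  refine ⟨⟨hF.of_le (by norm_cast), hc⟩, fun _ => rfl, fun x => ?_⟩
  have h1 := ((hg (‖under x‖ ^ 2)).hasSum (x 0)).mapL (scalarCLM m)
  have h2 := ((hh (‖under x‖ ^ 2)).hasSum (x 0)).smul_const (vec (under x))
  rw [hF']
  have e : ckTerm (F ∘ atZero) x = fun n =>
      scalarCLM m (x 0 ^ n / (n.factorial : ℝ) *
        iteratedDeriv n (fun a => g a (‖under x‖ ^ 2)) 0) +
      (x 0 ^ n / (n.factorial : ℝ) *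
        iteratedDeriv n (fun a => h a (‖under x‖ ^ 2)) 0) • vec (under x) := by
    funext n
    -- The sign in the CK series cancels the one from replacing `∂_{x̲}^n`, leaving plain Taylor
    -- terms in `x₀`.
    have h3 : (-(x 0)) ^ n / (n.factorial : ℝ) * (-1) ^ n = x 0 ^ n / (n.factorial : ℝ) := by
      rw [div_mul_eq_mul_div, ← mul_pow]
      simp
    rw [ckTerm, iterate_dirac_comp_atZero hF hc, Pi.smul_apply, smul_smul, h3,
      Function.comp_apply, iterate_partialZero_axial hg hh hF hF']
    simp only [radial, atZero_zero, under_atZero, scalarCLM_apply, Algebra.algebraMap_eq_smul_one]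
    module
  rw [e]
  exact h1.add h2

/-! ### The Gaussian -/

theorem axialLift_exp : axialLift (fun z => Complex.exp (z ^ 2 / 2)) (fun _ => (1 : Cl m)) =
    axial 0 := by
  funext x
  have h1 : ((⟨x 0, ‖under x‖⟩ : ℂ) ^ 2 / 2).re = (x 0 ^ 2 - ‖under x‖ ^ 2) / 2 := by
    simp [pow_two]
  have h2 : ((⟨x 0, ‖under x‖⟩ : ℂ) ^ 2 / 2).im = x 0 * ‖under x‖ := by
    simp [pow_two]
    ring
  have hc := bessel_zero_sq (x 0 * ‖under x‖)
  have hs := mul_bessel_one_sq (x 0 * ‖under x‖)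
  rw [mul_pow] at hc hs
  simp only [axialLift, mul_one, axial, Complex.exp_re, Complex.exp_im, h1, h2]
  rw [← vecCLM_apply, map_smul, vecCLM_apply, smul_smul, ← hc, ← hs]
  simp only [radial, evenPart, oddPart]
  congr 1
  · simp
  -- At `x̲ = 0` both vector parts vanish, so the equality holds on the whole space and the
  -- Laplacian can be iterated on the smooth right-hand side.
  · by_cases h : under x = 0
    · rw [h, ← vecCLM_apply, map_zero, smul_zero, smul_zero]
    · have := norm_ne_zero_iff.2 h
      congr 1
      simp
      field_simp

theorem prod_eq_doubleFactorial (N : ℕ) :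
    ∏ k ∈ Finset.range N, (((2 * N + 1 : ℕ) : ℝ) - 1 - 2 * k) =
      (Nat.doubleFactorial (2 * N) : ℝ) := by
  induction N with
  | zero => simp
  | succ N ih =>
    rw [Finset.prod_range_succ', show 2 * (N + 1) = 2 * N + 2 by ring, Nat.doubleFactorial_add_two,
      Nat.cast_mul, ← ih, mul_comm]
    congr 1
    · push_cast; ring
    · exact Finset.prod_congr rfl fun k _ => by push_cast; ring

theorem Ft_exp (N : ℕ) :
    Ft 0 (fun z => Complex.exp (z ^ 2 / 2)) (fun _ => (1 : Cl (2 * N + 1))) =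
      (Nat.doubleFactorial (2 * N) : ℝ) • axial N := by
  have h : 0 + (2 * N + 1 - 1) / 2 = N := by omega
  rw [Ft, axialLift_exp, h, iterate_laplacian_axial, prod_eq_doubleFactorial]

theorem evenPart_zero_left (n : ℕ) (s : ℝ) : evenPart n 0 s = (-1) ^ n * Real.exp (-s / 2) := by
  have h : bessel 0 0 = 1 := by simpa using bessel_zero_sq 0
  rw [evenPart, Finset.sum_range_succ']
  simp [h]

theorem oddPart_zero_left (n : ℕ) (s : ℝ) : oddPart n 0 s = 0 := by
  simp [oddPart]

theorem isCKExtension_gaussian (N : ℕ) :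
    IsCKExtension (gaussian (2 * N + 1)) ((-1 : ℝ) ^ N • axial N) := by
  have h : IsCKExtension (((-1 : ℝ) ^ N • axial N) ∘ atZero : _ → Cl (2 * N + 1))
      ((-1 : ℝ) ^ N • axial N) := by
    refine isCKExtension_of_axial (g := fun a s => (-1) ^ N * evenPart N a s)
      (h := fun a s => (-1) ^ N * oddPart N a s)
      (fun s => (realEntire_evenPart N s).const_mul _) (fun s => (realEntire_oddPart N s).const_mul _)
      (contDiff_const.smul (contDiff_axial N)) (fun x => ?_) fun x => ?_
    · simp only [Pi.smul_apply, axial, radial, Algebra.algebraMap_eq_smul_one]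
      module
    · have h1 : cauchyRiemann ((-1 : ℝ) ^ N • axial N) x =
          (-1 : ℝ) ^ N • cauchyRiemann (m := 2 * N + 1) (axial N) x := by
        have hd := (contDiff_axial (m := 2 * N + 1) N (k := 1)).differentiable one_ne_zero x
        simp only [cauchyRiemann, fderiv_const_smul hd, smul_apply,
          mul_smul_comm, smul_add, Finset.smul_sum]
      rw [h1, cauchyRiemann_axial]
      simp
  convert h using 1
  funext x
  have hN : ((-1 : ℝ) ^ N) * (-1) ^ N = 1 := by rw [← mul_pow]; simp
  simp only [gaussian, Function.comp_apply, Pi.smul_apply, axial, radial, atZero_zero,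
    under_atZero, evenPart_zero_left, oddPart_zero_left, zero_smul, add_zero,
    Algebra.algebraMap_eq_smul_one, smul_smul, ← mul_assoc, hN, one_mul]

theorem lowerD_cos (a : ℝ) (ν : ℕ) {r : ℝ} (hr : r ≠ 0) :
    lowerD ν (fun r => Real.cos (a * r)) r =
      (-1) ^ ν * (a ^ (2 * ν) * bessel ν (a ^ 2 * r ^ 2)) := by
  induction ν generalizing r with
  | zero => rw [lowerD, ← bessel_zero_sq, mul_pow]; simp
  | succ ν ih =>
    -- The formula for `ν` holds near `r`, away from `0`, which suffices for computing the
    -- derivative at `r`.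
    have h1 : lowerD ν (fun r => Real.cos (a * r)) =ᶠ[nhds r] _ :=
      (eventually_ne_nhds hr).mono fun t ht => ih ht
    have h2 := (((hasDerivAt_bessel_right ν a (r ^ 2)).comp r (hasDerivAt_pow 2 r)).const_mul
      (a ^ (2 * ν))).const_mul ((-1) ^ ν)
    simp only [lowerD]
    rw [h1.deriv_eq]
    refine (congrArg _ h2.deriv).trans ?_
    rw [show 2 * (ν + 1) = 2 * ν + 2 by ring]
    field_simp
    push_cast
    ring

/-- `D^r(ν)` is `D_r(ν)` conjugated by multiplication by `r`, and `sin (ar)/r = a J₁(a²r²)`. -/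
theorem upperD_sin (a : ℝ) (ν : ℕ) {r : ℝ} (hr : r ≠ 0) :
    upperD ν (fun r => Real.sin (a * r)) r =
      r * ((-1) ^ ν * (a ^ (2 * ν + 1) * bessel (ν + 1) (a ^ 2 * r ^ 2))) := by
  induction ν generalizing r with
  | zero => rw [upperD, ← mul_bessel_one_sq, mul_pow]; simp; ring
  | succ ν ih =>
    have h1 : (fun t => upperD ν (fun r => Real.sin (a * r)) t / t) =ᶠ[nhds r]
        fun t => (-1) ^ ν * (a ^ (2 * ν + 1) * bessel (ν + 1) (a ^ 2 * t ^ 2)) :=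
      (eventually_ne_nhds hr).mono fun t ht => by
        simp only [ih ht]
        field_simp
    have h2 := (((hasDerivAt_bessel_right (ν + 1) a (r ^ 2)).comp r
      (hasDerivAt_pow 2 r)).const_mul (a ^ (2 * ν + 1))).const_mul ((-1) ^ ν)
    rw [upperD, h1.deriv_eq]
    refine h2.deriv.trans ?_
    push_cast
    ring

theorem sum_lowerD_cos (N : ℕ) (a : ℝ) {r : ℝ} (hr : r ≠ 0) :
    Real.exp ((a ^ 2 - r ^ 2) / 2) * ∑ ν ∈ Finset.range (N + 1),
      (N.choose ν : ℝ) * (-1) ^ (N - ν) * lowerD ν (fun r => Real.cos (a * r)) r =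
    evenPart N a (r ^ 2) := by
  rw [evenPart, mul_comm ((-1 : ℝ) ^ N), mul_assoc, Finset.mul_sum (a := (-1 : ℝ) ^ N)]
  congr 1
  refine Finset.sum_congr rfl fun ν hν => ?_
  rw [lowerD_cos a ν hr, ← pow_sub_mul_pow (-1 : ℝ) (Finset.mem_range_succ_iff.1 hν)]
  ring

theorem sum_upperD_sin (N : ℕ) (a : ℝ) {r : ℝ} (hr : r ≠ 0) :
    Real.exp ((a ^ 2 - r ^ 2) / 2) * ∑ ν ∈ Finset.range (N + 1),
      (N.choose ν : ℝ) * (-1) ^ (N - ν) * upperD ν (fun r => Real.sin (a * r)) r =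
    r * oddPart N a (r ^ 2) := by
  rw [oddPart, mul_comm ((-1 : ℝ) ^ N), mul_assoc, Finset.mul_sum (a := (-1 : ℝ) ^ N),
    mul_left_comm r, Finset.mul_sum (a := r)]
  congr 1
  refine Finset.sum_congr rfl fun ν hν => ?_
  rw [upperD_sin a ν hr, ← pow_sub_mul_pow (-1 : ℝ) (Finset.mem_range_succ_iff.1 hν)]
  ring

/-- At `w = 0` the recurrence forces `J_n(0) = 1/(2n-1)!!`, so both sides equal `2^n N!/(N-n)!`. -/
theorem choose_mul_bessel_zero (N n : ℕ) (hn : n ≤ N) :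
    (N.choose n : ℝ) * bessel n 0 * ((2 * n).factorial : ℝ) =
      ∏ ν ∈ Finset.Icc 1 n, (((2 * N + 1 : ℕ) : ℝ) - (2 * (ν : ℝ) - 1)) := by
  induction n with
  | zero =>
    have h : bessel 0 0 = 1 := by simpa using bessel_zero_sq 0
    simp [h]
  | succ n ih =>
    rw [Finset.prod_Icc_succ_top (by omega), ← ih (by omega), ← mul_bessel_succ_zero n,
      show 2 * (n + 1) = 2 * n + 1 + 1 by ring, Nat.factorial_succ, Nat.factorial_succ]
    have h := N.choose_succ_right_eq n
    have h' : (N.choose (n + 1) : ℝ) * (n + 1) = N.choose n * (N - n) := by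
      rw [← Nat.cast_sub (by omega : n ≤ N)]
      exact_mod_cast h
    push_cast
    linear_combination 2 * bessel (n + 1) 0 * (2 * n + 1) * ((2 * n).factorial : ℝ) * h'

theorem evenPart_zero_right (N : ℕ) (a : ℝ) :
    (-1) ^ N * evenPart N a 0 = Real.exp (a ^ 2 / 2) *
      (1 + ∑ n ∈ Finset.Icc 1 N,
        (∏ ν ∈ Finset.Icc 1 n, (((2 * N + 1 : ℕ) : ℝ) - (2 * (ν : ℝ) - 1))) *
          (a ^ (2 * n) / ((2 * n).factorial : ℝ))) := by
  have hN : ((-1 : ℝ) ^ N) * (-1) ^ N = 1 := by rw [← mul_pow]; simp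
  have h : bessel 0 0 = 1 := by simpa using bessel_zero_sq 0
  rw [evenPart, ← mul_assoc, ← mul_assoc, hN, one_mul, sub_zero, Finset.range_eq_Ico,
    Finset.sum_eq_sum_Ico_succ_bot (by omega)]
  congr 2
  · simp [h]
  · refine Finset.sum_congr rfl fun n hn => ?_
    rw [← choose_mul_bessel_zero N n (by have := Finset.mem_Ico.1 hn; omega), mul_zero]
    have := (2 * n).factorial_ne_zero
    field_simp

end MonogenicGaussian

end

open MonogenicGaussian in
theorem proposition2 (m : ℕ) (hm : Odd m) :
    IsCKExtension (gaussian m) (CK (gaussian m)) ∧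
    (∀ x : EuclideanSpace ℝ (Fin (m + 1)), under x ≠ 0 →
      CK (gaussian m) x =
        ((-1 : ℝ) ^ ((m - 1) / 2) / (Nat.doubleFactorial (m - 1) : ℝ)) •
          Ft 0 (fun z => Complex.exp (z ^ 2 / 2)) (fun _ => 1) x) ∧
    (∀ x : EuclideanSpace ℝ (Fin (m + 1)), under x ≠ 0 →
      Ft 0 (fun z => Complex.exp (z ^ 2 / 2)) (fun _ => (1 : Cl m)) x =
        ((Nat.doubleFactorial (m - 1) : ℝ) * Real.exp ((x 0 ^ 2 - ‖under x‖ ^ 2) / 2)) •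
          (algebraMap ℝ (Cl m)
              (∑ ν ∈ Finset.range ((m - 1) / 2 + 1),
                (((m - 1) / 2).choose ν : ℝ) * (-1) ^ ((m - 1) / 2 - ν) *
                  lowerD ν (fun r => Real.cos (x 0 * r)) ‖under x‖) +
            (∑ ν ∈ Finset.range ((m - 1) / 2 + 1),
                (((m - 1) / 2).choose ν : ℝ) * (-1) ^ ((m - 1) / 2 - ν) *
                  upperD ν (fun r => Real.sin (x 0 * r)) ‖under x‖) •
              vec (‖under x‖⁻¹ • under x))) ∧
    (∀ x : EuclideanSpace ℝ (Fin (m + 1)), under x = 0 →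
      CK (gaussian m) x =
        algebraMap ℝ (Cl m) (Real.exp (x 0 ^ 2 / 2) *
          (1 + ∑ n ∈ Finset.Icc 1 ((m - 1) / 2),
            (∏ ν ∈ Finset.Icc 1 n, ((m : ℝ) - (2 * (ν : ℝ) - 1))) *
              (x 0 ^ (2 * n) / ((2 * n).factorial : ℝ))))) := by
  obtain ⟨N, rfl⟩ := hm
  have hN : (2 * N + 1 - 1) / 2 = N := by omega
  have hCK := isCKExtension_gaussian N
  rw [hN, Nat.add_sub_cancel, ← hCK.eq_CK, Ft_exp]
  refine ⟨hCK, fun x _ => ?_, fun x hx => ?_, fun x hx => ?_⟩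
  · have : (Nat.doubleFactorial (2 * N) : ℝ) ≠ 0 := by
      exact_mod_cast (Nat.doubleFactorial_pos _).ne'
    rw [Pi.smul_apply, Pi.smul_apply, smul_smul, div_mul_cancel₀ _ this]
  · have hr := norm_ne_zero_iff.2 hx
    rw [← vecCLM_apply (‖under x‖⁻¹ • under x), map_smul, vecCLM_apply, Pi.smul_apply, mul_smul,
      axial, radial, radial, ← sum_lowerD_cos N _ hr,
      -- The sine sum represents `r v_N`, so `v_N` is written as `r⁻¹ (r v_N)`; this `r⁻¹` is the
      -- one that turns `x̲` into `ω`.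
      ← inv_mul_cancel_left₀ hr (oddPart N (x 0) (‖under x‖ ^ 2)), ← sum_upperD_sin N _ hr]
    simp only [Algebra.algebraMap_eq_smul_one]
    module
  · rw [Pi.smul_apply, axial, radial, hx, ← vecCLM_apply, map_zero, smul_zero, add_zero, norm_zero,
      zero_pow two_ne_zero, ← evenPart_zero_right, Algebra.algebraMap_eq_smul_one,
      Algebra.algebraMap_eq_smul_one, smul_smul]
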